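/- Let $(X,d)$ be an infinite compact metric space. A continuous map $f\colon X\to X$ is called chaotic if there is a $\delta>0$ such that for every point $x\in X$ and every nonempty open set $V\subseteq X$ there is a point $y\in V$ with $\limsup_{n\to\infty} d(f^n(x),f^n(y))\ge\delta$ and $\liminf_{n\to\infty} d(f^n(x),f^n(y))=0$. The following maps are chaotic (in particular, they are continuous self-maps of infinite compact metric spaces): (a) the shift $\sigma(\beta_0\beta_1\beta_2\cdots)=\beta_1\beta_2\cdots$ on the space $\Sigma_2=\{0,1\}^{\{0,1,2,\dots\}}$ with the metric $d(\beta,\gamma)=\sum_{i=0}^\infty |\beta_i-\gamma_i|/2^{i+1}$; (b) the tent map $T(x)=1-|2x-1|$ on $[0,1]$ with the usual metric $|x-y|$; (c) for every real $\mu\ge 4$, the logistic map $F_\mu(x)=\mu x(1-x)$ restricted to the set $\Lambda_\mu=\bigcap_{n=0}^\infty F_\mu^{-n}([0,1])\subset\mathbb R$ with the usual metric $|x-y|$, where $F_\mu^{-n}([0,1])$ is the preimage of $[0,1]$ under the $n$-th iterate of $F_\mu\colon\mathbb R\to\mathbb R$; for $\mu=4$ this set is $\Lambda_4=[0,1]$.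 -/

import Mathlib

open Set Filter

/-- A self-map `f` of a metric space `X` is chaotic: `X` is an infinite compact metric space, `f` is
continuous, and there is `δ > 0` such that for every point `x` and every nonempty open set `V` some
`y ∈ V` satisfies `limsup d(fⁿ x, fⁿ y) ≥ δ` and `liminf d(fⁿ x, fⁿ y) = 0`.
(Since `X` is compact, the real sequences below are bounded, so the real-valued `limsup` and
`liminf` are the usual ones.) -/
structure IsChaotic {X : Type*} [MetricSpace X] (f : X → X) : Prop where
  infinite : Infinite X
  compact : CompactSpace X
  continuous : Continuous f
  exists_delta : ∃ δ : ℝ, 0 < δ ∧ ∀ x : X, ∀ V : Set X, IsOpen V → V.Nonempty → ∃ y ∈ V,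
    δ ≤ limsup (fun n : ℕ => dist (f^[n] x) (f^[n] y)) atTop ∧
    liminf (fun n : ℕ => dist (f^[n] x) (f^[n] y)) atTop = 0

/-- The set of all one-sided sequences of `0`s and `1`s. It carries the metric defined below, and no
other structure. -/
def SigmaTwo : Type := ℕ → Fin 2

namespace SigmaTwo

/-- The `i`-th term `|β_i - γ_i| / 2^(i+1)` of the series that defines the distance. -/
noncomputable def distTerm (β γ : SigmaTwo) (i : ℕ) : ℝ :=
  |((β i : ℕ) : ℝ) - ((γ i : ℕ) : ℝ)| / 2 ^ (i + 1)

theorem distTerm_nonneg (β γ : SigmaTwo) (i : ℕ) : 0 ≤ distTerm β γ i := by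
  unfold distTerm; positivity

theorem summable_distTerm (β γ : SigmaTwo) : Summable (distTerm β γ) := by
  refine Summable.of_nonneg_of_le (distTerm_nonneg β γ) (fun i => ?_) summable_geometric_two
  have h1 : |((β i : ℕ) : ℝ) - ((γ i : ℕ) : ℝ)| ≤ 1 := by
    have hb : ((β i : ℕ) : ℝ) ≤ 1 := by exact_mod_cast Nat.lt_succ_iff.mp (β i).isLt
    have hc : ((γ i : ℕ) : ℝ) ≤ 1 := by exact_mod_cast Nat.lt_succ_iff.mp (γ i).isLt
    have hb0 : (0 : ℝ) ≤ ((β i : ℕ) : ℝ) := Nat.cast_nonneg _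
    have hc0 : (0 : ℝ) ≤ ((γ i : ℕ) : ℝ) := Nat.cast_nonneg _
    rw [abs_le]; constructor <;> linarith
  unfold distTerm
  rw [one_div, inv_pow, ← one_div]
  apply div_le_div₀ zero_le_one h1 (by positivity)
  exact pow_le_pow_right₀ one_le_two (Nat.le_succ i)

/-- The metric `d(β, γ) = ∑_{i ≥ 0} |β_i - γ_i| / 2^(i+1)`. -/
noncomputable instance : MetricSpace SigmaTwo where
  dist β γ := ∑' i : ℕ, |((β i : ℕ) : ℝ) - ((γ i : ℕ) : ℝ)| / 2 ^ (i + 1)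
  dist_self β := by simp
  dist_comm β γ := by
    refine tsum_congr fun i => ?_
    rw [abs_sub_comm]
  dist_triangle β γ κ := by
    have h := Summable.tsum_le_tsum (f := distTerm β κ)
      (g := fun i => distTerm β γ i + distTerm γ κ i) (fun i => ?_)
      (summable_distTerm β κ) ((summable_distTerm β γ).add (summable_distTerm γ κ))
    · rw [(summable_distTerm β γ).tsum_add (summable_distTerm γ κ)] at h
      exact h
    · unfold distTerm
      rw [← add_div]
      gcongr
      exact abs_sub_le _ _ _
  eq_of_dist_eq_zero := by
    intro β γ h
    have h0 : HasSum (distTerm β γ) 0 := by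
      rw [← h]; exact (summable_distTerm β γ).hasSum
    have h1 := (hasSum_zero_iff_of_nonneg (distTerm_nonneg β γ)).mp h0
    funext i
    have h2 : distTerm β γ i = 0 := congrFun h1 i
    unfold distTerm at h2
    have h3 : |((β i : ℕ) : ℝ) - ((γ i : ℕ) : ℝ)| = 0 := by
      rcases div_eq_zero_iff.mp h2 with h | h
      · exact h
      · exact absurd h (by positivity)
    exact Fin.ext (by exact_mod_cast sub_eq_zero.mp (abs_eq_zero.mp h3))

/-- The shift `σ(β₀β₁β₂⋯) = β₁β₂⋯`. -/
def shift (β : SigmaTwo) : SigmaTwo := fun i => β (i + 1)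

end SigmaTwo

/-- The formula `T(x) = 1 - |2x - 1|` of the tent map. -/
noncomputable def tent (x : ℝ) : ℝ := 1 - |2 * x - 1|

theorem tent_mapsTo : MapsTo tent (Icc 0 1) (Icc 0 1) := by
  rintro x ⟨h0, h1⟩
  have h : |2 * x - 1| ≤ 1 := by rw [abs_le]; constructor <;> linarith
  have h' := abs_nonneg (2 * x - 1)
  unfold tent
  constructor <;> linarith

/-- The tent map as a self-map of `[0, 1]`. -/
noncomputable def tentMap : Icc (0 : ℝ) 1 → Icc (0 : ℝ) 1 :=
  tent_mapsTo.restrict tent (Icc 0 1) (Icc 0 1)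

/-- The logistic family `F_μ(x) = μ x (1 - x)` on the real line. -/
def logistic (μ x : ℝ) : ℝ := μ * x * (1 - x)

/-- `Λ_μ = ⋂_{n ≥ 0} F_μ^{-n}([0, 1])`. For `μ = 4` this is `[0, 1]`, see `logisticSet_four`. -/
def logisticSet (μ : ℝ) : Set ℝ := ⋂ n : ℕ, (logistic μ)^[n] ⁻¹' Icc 0 1

theorem logisticSet_four : logisticSet 4 = Icc 0 1 := by
  have hm : MapsTo (logistic 4) (Icc 0 1) (Icc 0 1) := by
    rintro x ⟨h0, h1⟩
    unfold logistic
    constructor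
    · have := mul_nonneg h0 (sub_nonneg.mpr h1); nlinarith
    · nlinarith [sq_nonneg (2 * x - 1)]
  apply Subset.antisymm
  · intro x hx
    exact mem_iInter.mp hx 0
  · intro x hx
    exact mem_iInter.mpr fun n => hm.iterate n hx

theorem logistic_mapsTo (μ : ℝ) : MapsTo (logistic μ) (logisticSet μ) (logisticSet μ) := by
  intro x hx
  exact mem_iInter.mpr fun n => mem_iInter.mp hx (n + 1)

/-- The restriction of `F_μ` to a self-map of `Λ_μ`. -/
def logisticMap (μ : ℝ) : logisticSet μ → logisticSet μ :=
  (logistic_mapsTo μ).restrict (logistic μ) (logisticSet μ) (logisticSet μ)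

/-! All three maps are locally eventually onto: each nonempty open set is mapped onto the whole
space by all large iterates. Then, for fixed `x`, the `y` whose orbit is far from (or close to) that
of `x` at some time `n ≥ N` form a dense open set, and Baire's theorem gives one `y ∈ V` that is far
infinitely often and arbitrarily close infinitely often. The onto property follows in
`isChaotic_of_contracting_branches` from inverse branches that halve distances in a coordinate `θ`:
an `n`-fold branch through `z` sends all of `X` near `z`. For the shift and the tent map `θ` is the
given coordinate; for the logistic map it is the angle `arcsin √x`, in which the branches halve
distances at `μ = 4` and contract at least as much for larger `μ`. -/

/-- A continuous self-map of a nontrivial compact metric space that is locally eventually onto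
satisfies the last clause in the definition of `IsChaotic`. -/
theorem exists_delta_of_locally_eventually_onto {X : Type*} [MetricSpace X] [CompactSpace X]
    [Nontrivial X] {f : X → X} (hf : Continuous f)
    (honto : ∀ V : Set X, IsOpen V → V.Nonempty →
      ∀ᶠ n in atTop, ∀ w : X, ∃ y ∈ V, f^[n] y = w) :
    ∃ δ : ℝ, 0 < δ ∧ ∀ x : X, ∀ V : Set X, IsOpen V → V.Nonempty → ∃ y ∈ V,
      δ ≤ limsup (fun n : ℕ => dist (f^[n] x) (f^[n] y)) atTop ∧
      liminf (fun n : ℕ => dist (f^[n] x) (f^[n] y)) atTop = 0 := by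
  obtain ⟨a, b, hab⟩ := exists_pair_ne X
  have hpos : 0 < dist a b := dist_pos.mpr hab
  -- Any constant below `dist a b / 2` would do: no point is that close to both `a` and `b`.
  refine ⟨dist a b / 3, by positivity, fun x V hV hVne => ?_⟩
  have hfar : ∀ n, ∃ w, dist a b / 3 < dist (f^[n] x) w := by
    intro n
    by_contra! h
    have := dist_triangle_left a b (f^[n] x)
    linarith [h a, h b]
  have hopen : ∀ n, Continuous fun y => dist (f^[n] x) (f^[n] y) := fun n =>
    continuous_const.dist (hf.iterate n)
  have hdense : ∀ p : ℕ → X → Prop, (∀ n, ∃ w, p n w) →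
      ∀ N, Dense (⋃ n ≥ N, {y | p n (f^[n] y)}) := by
    intro p hp N
    rw [dense_iff_inter_open]
    intro U hU hUne
    obtain ⟨n, hn, hnN⟩ := ((honto U hU hUne).and (eventually_ge_atTop N)).exists
    obtain ⟨w, hw⟩ := hp n
    obtain ⟨y, hy, hyw⟩ := hn w
    refine ⟨y, hy, mem_iUnion₂.mpr ⟨n, hnN, ?_⟩⟩
    change p n (f^[n] y)
    rwa [hyw]
  have hD1 : Dense (⋂ N : ℕ, ⋃ n ≥ N, {y | dist a b / 3 < dist (f^[n] x) (f^[n] y)}) :=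
    dense_iInter_of_isOpen
      (fun N => isOpen_biUnion fun n _ => isOpen_lt continuous_const (hopen n))
      (hdense (fun n w => dist a b / 3 < dist (f^[n] x) w) hfar)
  have hG1 : IsGδ (⋂ N : ℕ, ⋃ n ≥ N, {y | dist a b / 3 < dist (f^[n] x) (f^[n] y)}) :=
    IsGδ.iInter_of_isOpen
      (fun N => isOpen_biUnion fun n _ => isOpen_lt continuous_const (hopen n))
  have hclose : ∀ q : ℕ × ℕ, IsOpen
      (⋃ n ≥ q.1, {y | dist (f^[n] x) (f^[n] y) < 1 / ((q.2 : ℝ) + 1)}) := fun q =>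
    isOpen_biUnion fun n _ => isOpen_lt (hopen n) continuous_const
  have hD2 : Dense (⋂ q : ℕ × ℕ,
      ⋃ n ≥ q.1, {y | dist (f^[n] x) (f^[n] y) < 1 / ((q.2 : ℝ) + 1)}) :=
    dense_iInter_of_isOpen hclose fun q =>
      hdense (fun n w => dist (f^[n] x) w < 1 / ((q.2 : ℝ) + 1))
        (fun n => ⟨f^[n] x, by rw [dist_self]; positivity⟩) q.1
  -- Baire: two dense Gδ sets have dense intersection, which therefore meets `V`.
  obtain ⟨y, hyV, hy1, hy2⟩ :=
    (hD1.inter_of_Gδ hG1 (IsGδ.iInter_of_isOpen hclose) hD2).inter_open_nonempty V hV hVne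
  have hbdd : ∀ n, dist (f^[n] x) (f^[n] y) ≤ Metric.diam (univ : Set X) := fun n =>
    Metric.dist_le_diam_of_mem isCompact_univ.isBounded (mem_univ _) (mem_univ _)
  have hba : IsBoundedUnder (· ≤ ·) atTop fun n : ℕ => dist (f^[n] x) (f^[n] y) :=
    isBoundedUnder_of ⟨_, hbdd⟩
  have hbb : IsBoundedUnder (· ≥ ·) atTop fun n : ℕ => dist (f^[n] x) (f^[n] y) :=
    isBoundedUnder_of ⟨0, fun n => dist_nonneg⟩
  refine ⟨y, hyV, le_limsup_of_frequently_le ?_ hba, le_antisymm ?_ ?_⟩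
  · rw [frequently_atTop]
    intro N
    obtain ⟨n, hn, h⟩ := mem_iUnion₂.mp (mem_iInter.mp hy1 N)
    exact ⟨n, hn, le_of_lt h⟩
  · refine le_of_forall_pos_le_add fun ε hε => ?_
    obtain ⟨k, hk⟩ := exists_nat_one_div_lt hε
    rw [zero_add]
    refine liminf_le_of_frequently_le ?_ hbb
    rw [frequently_atTop]
    intro N
    obtain ⟨n, hn, h⟩ := mem_iUnion₂.mp (mem_iInter.mp hy2 (N, k))
    exact ⟨n, hn, (lt_trans h hk).le⟩
  · exact le_liminf_of_le hba.isCoboundedUnder_ge (Eventually.of_forall fun n => dist_nonneg)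

/-- Compositions of inverse branches that contract by `1/2`. -/
theorem exists_iterate_branch {X Y ι : Type*} [PseudoMetricSpace Y] {f : X → X} {θ : X → Y}
    {g : ι → X → X} (hfg : ∀ i x, f (g i x) = x) (hcover : ∀ x, ∃ i, g i (f x) = x)
    (hcontr : ∀ i x y, dist (θ (g i x)) (θ (g i y)) ≤ 1 / 2 * dist (θ x) (θ y)) (n : ℕ) (x : X) :
    ∃ G : X → X, (∀ y, f^[n] (G y) = y) ∧ G (f^[n] x) = x ∧
      ∀ y z, dist (θ (G y)) (θ (G z)) ≤ (1 / 2) ^ n * dist (θ y) (θ z) := by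
  induction n generalizing x with
  | zero => exact ⟨id, fun y => rfl, rfl, fun y z => by simp⟩
  | succ n ih =>
    obtain ⟨G, h1, h2, h3⟩ := ih (f x)
    obtain ⟨i, hi⟩ := hcover x
    refine ⟨g i ∘ G, fun y => ?_, ?_, fun y z => ?_⟩
    · rw [Function.iterate_succ_apply, Function.comp_apply, hfg, h1]
    · rw [Function.iterate_succ_apply, Function.comp_apply, h2, hi]
    · refine (hcontr i _ _).trans ?_
      rw [pow_succ', mul_assoc]
      gcongr
      exact h3 y z

/-- A continuous non-injective self-map of a compact metric space is chaotic if it has inverse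
branches which cover the space and contract by `1/2` for a compatible metric. -/
theorem isChaotic_of_contracting_branches {X Y ι : Type*} [MetricSpace X] [CompactSpace X]
    [PseudoMetricSpace Y] {f : X → X} (hf : Continuous f) (hinj : ¬ Function.Injective f)
    {θ : X → Y} (hθ : Topology.IsInducing θ) {g : ι → X → X} (hfg : ∀ i x, f (g i x) = x)
    (hcover : ∀ x, ∃ i, g i (f x) = x)
    (hcontr : ∀ i x y, dist (θ (g i x)) (θ (g i y)) ≤ 1 / 2 * dist (θ x) (θ y)) :
    IsChaotic f := by
  have hsurj : Function.Surjective f := fun x => by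
    obtain ⟨i, -⟩ := hcover x
    exact ⟨g i x, hfg i x⟩
  have hinf : Infinite X := by
    -- On a finite set a surjective self-map is injective.
    by_contra h
    rw [not_infinite_iff_finite] at h
    exact hinj (Finite.injective_iff_surjective.mpr hsurj)
  refine ⟨hinf, inferInstance, hf, exists_delta_of_locally_eventually_onto hf ?_⟩
  rintro V hV ⟨z, hz⟩
  obtain ⟨U, hU, rfl⟩ := hθ.isOpen_iff.mp hV
  obtain ⟨ε, hε, hball⟩ := Metric.isOpen_iff.mp hU (θ z) hz
  have hbdd := (isCompact_range hθ.continuous).isBounded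
  have hlim : Tendsto (fun n : ℕ => (1 / 2 : ℝ) ^ n * Metric.diam (range θ)) atTop (nhds 0) := by
    simpa using (tendsto_pow_atTop_nhds_zero_of_lt_one (r := (1 / 2 : ℝ))
      (by norm_num) (by norm_num)).mul_const (Metric.diam (range θ))
  filter_upwards [hlim.eventually (gt_mem_nhds hε)] with n hn w
  obtain ⟨G, h1, h2, h3⟩ := exists_iterate_branch hfg hcover hcontr n z
  refine ⟨G w, hball ?_, h1 w⟩
  rw [Metric.mem_ball]
  refine lt_of_le_of_lt ?_ hn
  have h4 := h3 w (f^[n] z)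
  rw [h2] at h4
  refine h4.trans ?_
  gcongr
  exact Metric.dist_le_diam_of_mem hbdd (mem_range_self _) (mem_range_self _)

/-! ### The shift -/

namespace SigmaTwo

theorem dist_eq_tsum (β γ : SigmaTwo) : dist β γ = ∑' i, distTerm β γ i := rfl

instance : CompactSpace SigmaTwo := by
  -- The identity from the compact product space; it is continuous because the distance series
  -- converges uniformly.
  let e : (ℕ → Fin 2) → SigmaTwo := fun β => β
  have he : Continuous e := by
    rw [continuous_iff_continuousAt]
    intro β₀
    rw [ContinuousAt, tendsto_iff_dist_tendsto_zero]
    have hc : Continuous fun β : ℕ → Fin 2 => ∑' i, distTerm (e β) (e β₀) i := by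
      refine continuous_tsum (u := fun i : ℕ => 1 / 2 * (1 / 2 : ℝ) ^ i) (fun i => ?_)
        (summable_geometric_two.mul_left _) (fun i β => ?_)
      · have : Continuous fun b : Fin 2 =>
            |((b : ℕ) : ℝ) - ((β₀ i : ℕ) : ℝ)| / 2 ^ (i + 1) := continuous_of_discreteTopology
        exact this.comp (continuous_apply i)
      · rw [Real.norm_of_nonneg (distTerm_nonneg _ _ _), ← pow_succ', one_div, inv_pow, ← one_div]
        unfold distTerm
        gcongr
        have hb : ((e β i : ℕ) : ℝ) ≤ 1 := by exact_mod_cast Nat.lt_succ_iff.mp (e β i).isLt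
        have hc : ((e β₀ i : ℕ) : ℝ) ≤ 1 := by exact_mod_cast Nat.lt_succ_iff.mp (e β₀ i).isLt
        rw [abs_le]
        constructor <;> linarith [Nat.cast_nonneg (α := ℝ) (e β i : ℕ),
          Nat.cast_nonneg (α := ℝ) (e β₀ i : ℕ)]
    have h := hc.tendsto β₀
    rwa [← dist_eq_tsum, dist_self] at h
  have hs : Function.Surjective e := fun β => ⟨β, rfl⟩
  exact hs.compactSpace he

/-- Splitting off the first term shows both that the shift is 2-Lipschitz and that prepending a
symbol halves distances. -/
theorem dist_eq_add_shift (β γ : SigmaTwo) :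
    dist β γ = distTerm β γ 0 + 1 / 2 * dist (shift β) (shift γ) := by
  rw [dist_eq_tsum, dist_eq_tsum, (summable_distTerm β γ).tsum_eq_zero_add, ← tsum_mul_left]
  congr 1
  refine tsum_congr fun i => ?_
  unfold distTerm shift
  rw [pow_succ 2 (i + 1)]
  field_simp

/-- The sequence `iβ₀β₁⋯`. -/
def cons (i : Fin 2) (β : SigmaTwo) : SigmaTwo := fun n => Nat.casesOn n i β

theorem shift_cons (i : Fin 2) (β : SigmaTwo) : shift (cons i β) = β := rfl

theorem isChaotic_shift : IsChaotic shift := by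
  refine isChaotic_of_contracting_branches (θ := id) (g := cons) ?_ ?_ Topology.IsInducing.id
    shift_cons (fun β => ⟨β 0, ?_⟩) fun i β γ => ?_
  · refine (LipschitzWith.of_dist_le_mul (K := 2) fun β γ => ?_).continuous
    have := distTerm_nonneg β γ 0
    rw [dist_eq_add_shift β γ, NNReal.coe_ofNat]
    linarith
  · intro h
    have h1 : cons 0 (fun _ => 0) = cons 1 (fun _ => 0) := h rfl
    exact absurd (congrFun h1 0) (by simp [cons])
  · funext n
    cases n <;> rfl
  · have h : distTerm (cons i β) (cons i γ) 0 = 0 := by simp [distTerm, cons]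
    change dist (cons i β) (cons i γ) ≤ 1 / 2 * dist β γ
    rw [dist_eq_add_shift, h, zero_add]
    rfl

end SigmaTwo

/-! ### The tent map -/

/-- The inverse branches `y / 2` and `1 - y / 2` of the tent map. -/
noncomputable def tentBranch (i : Bool) (y : Icc (0 : ℝ) 1) : Icc (0 : ℝ) 1 :=
  ⟨if i then 1 - (y : ℝ) / 2 else (y : ℝ) / 2, by
    obtain ⟨y, h0, h1⟩ := y
    cases i <;> constructor <;> simp <;> linarith⟩

theorem isChaotic_tentMap : IsChaotic tentMap := by
  refine isChaotic_of_contracting_branches (θ := Subtype.val) (g := tentBranch) ?_ ?_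
    Topology.IsInducing.subtypeVal ?_ ?_ ?_
  · refine Continuous.subtype_mk (f := fun x : Icc (0 : ℝ) 1 => tent x) ?_ _
    unfold tent
    fun_prop
  · intro h
    have h1 : tentMap ⟨0, by simp⟩ = tentMap ⟨1, by simp⟩ := Subtype.ext (by
      change tent 0 = tent 1
      norm_num [tent])
    simpa using congrArg Subtype.val (h h1)
  · rintro i ⟨y, h0, h1⟩
    refine Subtype.ext ?_
    change 1 - |2 * (if i then 1 - y / 2 else y / 2) - 1| = y
    cases i
    · rw [abs_of_nonpos] <;> simp <;> linarith
    · rw [abs_of_nonneg] <;> simp <;> linarith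
  · rintro ⟨x, h0, h1⟩
    rcases le_total (2 * x) 1 with h | h
    · refine ⟨false, Subtype.ext ?_⟩
      change (1 - |2 * x - 1|) / 2 = x
      rw [abs_of_nonpos] <;> linarith
    · refine ⟨true, Subtype.ext ?_⟩
      change 1 - (1 - |2 * x - 1|) / 2 = x
      rw [abs_of_nonneg] <;> linarith
  · rintro i ⟨x, hx⟩ ⟨y, hy⟩
    rw [Real.dist_eq, Real.dist_eq]
    refine le_of_eq ?_
    have h2 : (1 / 2 : ℝ) = |1 / 2| := by norm_num
    rw [h2, ← abs_mul]
    cases i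
    · change |x / 2 - y / 2| = |1 / 2 * (x - y)|
      congr 1; ring
    · change |(1 - x / 2) - (1 - y / 2)| = |1 / 2 * (x - y)|
      rw [← abs_neg]
      congr 1; ring

/-! ### The logistic maps -/

theorem isClosed_logisticSet (μ : ℝ) : IsClosed (logisticSet μ) := by
  have hc : Continuous (logistic μ) := by unfold logistic; fun_prop
  exact isClosed_iInter fun n => isClosed_Icc.preimage (hc.iterate n)

theorem logisticSet_subset (μ : ℝ) : logisticSet μ ⊆ Icc 0 1 := fun _ hx => mem_iInter.mp hx 0

instance (μ : ℝ) : CompactSpace (logisticSet μ) :=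
  isCompact_iff_compactSpace.mp
    (isCompact_Icc.of_isClosed_subset (isClosed_logisticSet μ) (logisticSet_subset μ))

theorem mem_logisticSet_of_logistic_mem {μ x : ℝ} (hx : x ∈ Icc (0 : ℝ) 1)
    (h : logistic μ x ∈ logisticSet μ) : x ∈ logisticSet μ := by
  refine mem_iInter.mpr fun n => ?_
  cases n with
  | zero => exact hx
  | succ n => exact mem_iInter.mp h n

/-- The derivative is nonnegative since `c ≤ 1` and `(c * t) ^ 2 ≤ t ^ 2`. This is what handles `μ >
4`, with `c = 2 / √μ`. -/
theorem monotoneOn_arcsin_sub_arcsin_mul {c : ℝ} (h0 : 0 ≤ c) (h1 : c ≤ 1) :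
    MonotoneOn (fun t => Real.arcsin t - Real.arcsin (c * t)) (Icc 0 1) := by
  have hd : ∀ t ∈ Ioo (0 : ℝ) 1, HasDerivAt (fun t => Real.arcsin t - Real.arcsin (c * t))
      (1 / √(1 - t ^ 2) - 1 / √(1 - (c * t) ^ 2) * (c * 1)) t := by
    rintro t ⟨ht0, ht1⟩
    have hct : c * t < 1 := by nlinarith
    have hct0 : 0 ≤ c * t := by positivity
    exact (Real.hasDerivAt_arcsin (by linarith) ht1.ne).sub
      ((Real.hasDerivAt_arcsin (by linarith) hct.ne).comp t ((hasDerivAt_id t).const_mul c))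
  refine monotoneOn_of_deriv_nonneg (convex_Icc 0 1) ?_ ?_ ?_
  · exact (Real.continuous_arcsin.sub
      (Real.continuous_arcsin.comp (continuous_const.mul continuous_id))).continuousOn
  · rw [interior_Icc]
    exact fun t ht => (hd t ht).differentiableAt.differentiableWithinAt
  · rw [interior_Icc]
    intro t ht
    rw [(hd t ht).deriv, sub_nonneg, mul_one]
    have hct : (c * t) ^ 2 ≤ t ^ 2 := by
      have : c * t ≤ t := by nlinarith [ht.1]
      have h : 0 ≤ c * t := mul_nonneg h0 ht.1.le
      gcongr
    have hp : 0 < 1 - t ^ 2 := by nlinarith [ht.1, ht.2]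
    calc 1 / √(1 - (c * t) ^ 2) * c ≤ 1 / √(1 - (c * t) ^ 2) * 1 := by gcongr
      _ ≤ 1 / √(1 - t ^ 2) := by
        rw [mul_one]
        gcongr

theorem abs_arcsin_mul_sub_le {c s t : ℝ} (h0 : 0 ≤ c) (h1 : c ≤ 1) (hs : s ∈ Icc (0 : ℝ) 1)
    (ht : t ∈ Icc (0 : ℝ) 1) :
    |Real.arcsin (c * s) - Real.arcsin (c * t)| ≤ |Real.arcsin s - Real.arcsin t| := by
  wlog hst : s ≤ t generalizing s t
  · rw [abs_sub_comm, abs_sub_comm (Real.arcsin s)]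
    exact this ht hs (le_of_not_ge hst)
  have h := monotoneOn_arcsin_sub_arcsin_mul h0 h1 hs ht hst
  have h2 := Real.monotone_arcsin hst
  have h3 := Real.monotone_arcsin (mul_le_mul_of_nonneg_left hst h0)
  simp only at h
  rw [abs_sub_comm, abs_sub_comm (Real.arcsin s), abs_of_nonneg (by linarith),
    abs_of_nonneg (by linarith)]
  linarith

/-- The lower inverse branch of the logistic map in the coordinate `ψ` with `x = sin² ψ`. -/
noncomputable def logisticAngle (μ y : ℝ) : ℝ := Real.arcsin (2 / √μ * √y) / 2

theorem two_div_sqrt_le_one {μ : ℝ} (hμ : 4 ≤ μ) : 2 / √μ ≤ 1 := by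
  have h : (2 : ℝ) ≤ √μ := Real.le_sqrt_of_sq_le (by linarith)
  rw [div_le_one (by linarith)]
  exact h

theorem logisticAngle_mem (μ y : ℝ) : logisticAngle μ y ∈ Icc 0 (Real.pi / 4) := by
  have h := Real.arcsin_le_pi_div_two (2 / √μ * √y)
  have h' : 0 ≤ Real.arcsin (2 / √μ * √y) := Real.arcsin_nonneg.mpr (by positivity)
  unfold logisticAngle
  constructor <;> linarith

/-- Square `2 sin ψ cos ψ = sin 2ψ = 2 √y / √μ`. -/
theorem mul_sin_sq_mul_cos_sq_logisticAngle {μ y : ℝ} (hμ : 4 ≤ μ) (hy : y ∈ Icc (0 : ℝ) 1) :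
    μ * Real.sin (logisticAngle μ y) ^ 2 * Real.cos (logisticAngle μ y) ^ 2 = y := by
  have h1 : 2 / √μ * √y ≤ 1 :=
    mul_le_one₀ (two_div_sqrt_le_one hμ) (Real.sqrt_nonneg _) (Real.sqrt_le_one.mpr hy.2)
  have h2 : 0 ≤ 2 / √μ * √y := by positivity
  have h3 : Real.sin (2 * logisticAngle μ y) = 2 / √μ * √y := by
    rw [logisticAngle, mul_div_cancel₀ _ two_ne_zero, Real.sin_arcsin (by linarith) h1]
  rw [Real.sin_two_mul] at h3
  have h4 := congrArg (· ^ 2) h3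
  simp only [mul_pow, div_pow] at h4
  rw [Real.sq_sqrt hy.1, Real.sq_sqrt (by linarith)] at h4
  have h5 : μ ≠ 0 := by linarith
  field_simp at h4
  linarith

/-- The inverse branches `sin² ψ` and `cos² ψ` of the logistic map. -/
noncomputable def logisticBranch {μ : ℝ} (hμ : 4 ≤ μ) (i : Bool) (y : logisticSet μ) :
    logisticSet μ :=
  ⟨if i then Real.cos (logisticAngle μ y) ^ 2 else Real.sin (logisticAngle μ y) ^ 2, by
    have h := mul_sin_sq_mul_cos_sq_logisticAngle hμ (logisticSet_subset μ y.2)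
    have hc := Real.cos_sq' (logisticAngle μ y)
    have hs := Real.sin_sq (logisticAngle μ y)
    refine mem_logisticSet_of_logistic_mem ?_ ?_
    · cases i
      · exact ⟨sq_nonneg _, Real.sin_sq_le_one _⟩
      · exact ⟨sq_nonneg _, Real.cos_sq_le_one _⟩
    · convert y.2 using 1
      refine Eq.trans ?_ h
      cases i
      · simp only [logistic, Bool.false_eq_true, if_false]
        rw [← hc]
      · simp only [logistic, if_true]
        rw [← hs]; ring⟩

theorem logisticMap_logisticBranch {μ : ℝ} (hμ : 4 ≤ μ) (i : Bool) (y : logisticSet μ) :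
    logisticMap μ (logisticBranch hμ i y) = y := by
  refine Subtype.ext (Eq.trans ?_
    (mul_sin_sq_mul_cos_sq_logisticAngle hμ (logisticSet_subset μ y.2)))
  cases i
  · change μ * Real.sin (logisticAngle μ y) ^ 2 * (1 - Real.sin (logisticAngle μ y) ^ 2) = _
    rw [← Real.cos_sq']
  · change μ * Real.cos (logisticAngle μ y) ^ 2 * (1 - Real.cos (logisticAngle μ y) ^ 2) = _
    rw [← Real.sin_sq]; ring

/-- The factor `√μ` cancels. The right side is not simplified to `τ`, because `2 * τ` may exceed `π
/ 2`. -/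
theorem logisticAngle_logistic_sin_sq {μ τ : ℝ} (hμ : 4 ≤ μ) (hτ : τ ∈ Icc 0 (Real.pi / 2)) :
    logisticAngle μ (logistic μ (Real.sin τ ^ 2)) = Real.arcsin (Real.sin (2 * τ)) / 2 := by
  have hs : 0 ≤ Real.sin τ := Real.sin_nonneg_of_nonneg_of_le_pi hτ.1 (by
    linarith [hτ.2, Real.pi_pos])
  have hc : 0 ≤ Real.cos τ := Real.cos_nonneg_of_neg_pi_div_two_le_of_le (by
    linarith [hτ.1, Real.pi_pos]) hτ.2
  have hp : √μ ≠ 0 := (Real.sqrt_pos.mpr (by linarith)).ne'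
  have h : √(logistic μ (Real.sin τ ^ 2)) = √μ * (Real.sin τ * Real.cos τ) := by
    rw [logistic, ← Real.cos_sq', mul_assoc, ← mul_pow, Real.sqrt_mul (by linarith),
      Real.sqrt_sq (by positivity)]
  rw [logisticAngle, h, Real.sin_two_mul]
  congr 2
  field_simp

theorem arcsin_sqrt_mem (x : ℝ) : Real.arcsin √x ∈ Icc 0 (Real.pi / 2) :=
  ⟨Real.arcsin_nonneg.mpr (Real.sqrt_nonneg x), Real.arcsin_le_pi_div_two _⟩

theorem sin_arcsin_sqrt_sq {x : ℝ} (hx : x ∈ Icc (0 : ℝ) 1) : Real.sin (Real.arcsin √x) ^ 2 = x := by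
  rw [Real.sin_arcsin (by linarith [Real.sqrt_nonneg x]) (Real.sqrt_le_one.mpr hx.2),
    Real.sq_sqrt hx.1]

theorem exists_logisticBranch_eq {μ : ℝ} (hμ : 4 ≤ μ) (x : logisticSet μ) :
    ∃ i, logisticBranch hμ i (logisticMap μ x) = x := by
  have hτ := arcsin_sqrt_mem (x : ℝ)
  have hx := sin_arcsin_sqrt_sq (logisticSet_subset μ x.2)
  have hψ := logisticAngle_logistic_sin_sq hμ hτ
  set τ := Real.arcsin √(x : ℝ)
  rw [hx] at hψ
  -- `arcsin (sin 2τ)` is `2τ` in the first case and `π - 2τ` in the second, which selects the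
  -- branch.
  rcases le_total τ (Real.pi / 4) with h | h
  · refine ⟨false, Subtype.ext ?_⟩
    change Real.sin (logisticAngle μ (logistic μ x)) ^ 2 = x
    rw [hψ, Real.arcsin_sin (by linarith [hτ.1, Real.pi_pos]) (by linarith),
      mul_div_cancel_left₀ _ two_ne_zero, hx]
  · refine ⟨true, Subtype.ext ?_⟩
    change Real.cos (logisticAngle μ (logistic μ x)) ^ 2 = x
    rw [hψ, ← Real.sin_pi_sub, Real.arcsin_sin (by linarith [hτ.2]) (by linarith),
      show (Real.pi - 2 * τ) / 2 = Real.pi / 2 - τ by ring, Real.cos_pi_div_two_sub, hx]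

theorem arcsin_sqrt_logisticBranch {μ : ℝ} (hμ : 4 ≤ μ) (i : Bool) (y : logisticSet μ) :
    Real.arcsin √(logisticBranch hμ i y : ℝ) =
      if i then Real.pi / 2 - logisticAngle μ y else logisticAngle μ y := by
  have h := logisticAngle_mem μ y
  have hpi := Real.pi_pos
  cases i
  · change Real.arcsin √(Real.sin (logisticAngle μ y) ^ 2) = logisticAngle μ y
    rw [Real.sqrt_sq (Real.sin_nonneg_of_nonneg_of_le_pi h.1 (by linarith [h.2])),
      Real.arcsin_sin (by linarith [h.1]) (by linarith [h.2])]
  · change Real.arcsin √(Real.cos (logisticAngle μ y) ^ 2) = Real.pi / 2 - logisticAngle μ y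
    rw [Real.sqrt_sq (Real.cos_nonneg_of_neg_pi_div_two_le_of_le (by linarith [h.1])
      (by linarith [h.2])), ← Real.sin_pi_div_two_sub,
      Real.arcsin_sin (by linarith [h.2]) (by linarith [h.1])]

/-- On `[0, 1]` the coordinate has the continuous left inverse `sin²`. -/
theorem isInducing_arcsin_sqrt (μ : ℝ) :
    Topology.IsInducing fun x : logisticSet μ => Real.arcsin √(x : ℝ) := by
  refine Topology.IsInducing.of_comp (g := fun t : ℝ => Real.sin t ^ 2)
    (Real.continuous_arcsin.comp (Real.continuous_sqrt.comp continuous_subtype_val))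
    (by fun_prop) ?_
  convert Topology.IsInducing.subtypeVal (t := logisticSet μ) using 1
  funext x
  exact sin_arcsin_sqrt_sq (logisticSet_subset μ x.2)

/-- The factor `1 / 2` is the halving in `logisticAngle`; scaling by `2 / √μ ≤ 1` inside `arcsin`
only shrinks increments, and the upper branch reflects the lower one. -/
theorem dist_arcsin_sqrt_logisticBranch_le {μ : ℝ} (hμ : 4 ≤ μ) (i : Bool)
    (x y : logisticSet μ) :
    dist (Real.arcsin √(logisticBranch hμ i x : ℝ)) (Real.arcsin √(logisticBranch hμ i y : ℝ)) ≤
      1 / 2 * dist (Real.arcsin √(x : ℝ)) (Real.arcsin √(y : ℝ)) := by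
  have h : |logisticAngle μ x - logisticAngle μ y| ≤
      1 / 2 * |Real.arcsin √(x : ℝ) - Real.arcsin √(y : ℝ)| := by
    have h1 := abs_arcsin_mul_sub_le (by positivity) (two_div_sqrt_le_one hμ)
      ⟨Real.sqrt_nonneg (x : ℝ), Real.sqrt_le_one.mpr (logisticSet_subset μ x.2).2⟩
      ⟨Real.sqrt_nonneg (y : ℝ), Real.sqrt_le_one.mpr (logisticSet_subset μ y.2).2⟩
    rw [logisticAngle, logisticAngle, ← sub_div, abs_div, abs_two]
    linarith
  rw [arcsin_sqrt_logisticBranch, arcsin_sqrt_logisticBranch, Real.dist_eq, Real.dist_eq]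
  cases i
  · exact h
  · simp only [if_true]
    rw [sub_sub_sub_cancel_left, abs_sub_comm]
    exact h

theorem zero_mem_logisticSet (μ : ℝ) : (0 : ℝ) ∈ logisticSet μ := by
  have h : Function.IsFixedPt (logistic μ) 0 := by simp [Function.IsFixedPt, logistic]
  refine mem_iInter.mpr fun n => ?_
  rw [mem_preimage, (h.iterate n).eq]
  simp

theorem one_mem_logisticSet (μ : ℝ) : (1 : ℝ) ∈ logisticSet μ := by
  refine mem_logisticSet_of_logistic_mem (by simp) ?_
  simpa [logistic] using zero_mem_logisticSet μ

theorem isChaotic_logisticMap {μ : ℝ} (hμ : 4 ≤ μ) : IsChaotic (logisticMap μ) := by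
  refine isChaotic_of_contracting_branches ?_ ?_ (isInducing_arcsin_sqrt μ)
    (logisticMap_logisticBranch hμ) (exists_logisticBranch_eq hμ)
    (dist_arcsin_sqrt_logisticBranch_le hμ)
  · refine Continuous.subtype_mk (f := fun x : logisticSet μ => logistic μ x) ?_ _
    unfold logistic
    fun_prop
  · intro h
    have h1 : logisticMap μ ⟨0, zero_mem_logisticSet μ⟩ =
        logisticMap μ ⟨1, one_mem_logisticSet μ⟩ := Subtype.ext (by
      change logistic μ 0 = logistic μ 1
      simp [logistic])
    simpa using congrArg Subtype.val (h h1)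

theorem theorem3 :
    IsChaotic SigmaTwo.shift ∧
    IsChaotic tentMap ∧
    ∀ μ : ℝ, 4 ≤ μ → IsChaotic (logisticMap μ) :=
  ⟨SigmaTwo.isChaotic_shift, isChaotic_tentMap, fun _ hμ => isChaotic_logisticMap hμ⟩
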